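/- Let $d\ge 2$ and let $\|\cdot\|$ be any norm on $\mathbb{R}^d$. Let $P\subset\mathbb{R}^d$ be a $d$-polytope, i.e. the convex hull of finitely many points, of dimension $d$. Suppose that $P$ is subequilateral with respect to $\|\cdot\|$, i.e. for every edge (one-dimensional face) of $P$, with endpoints $x,y$ say, the length $\|x-y\|$ equals the diameter $\max_{u,v\in P}\|u-v\|$ of $P$. Then $P$ has at most $\left(\frac d2+1\right)^d$ vertices. -/

import Mathlib

/-- A polytope: the convex hull of finitely many points. -/
def IsPolytope {E : Type*} [AddCommGroup E] [Module ℝ E] (P : Set E) : Prop :=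
  ∃ s : Finset E, P = convexHull ℝ (s : Set E)

/-- A `d`-polytope: a polytope whose affine hull has dimension `d`. -/
def IsDPolytope {E : Type*} [AddCommGroup E] [Module ℝ E] (d : ℕ) (P : Set E) : Prop :=
  IsPolytope P ∧ Module.finrank ℝ (vectorSpan ℝ P) = d

/-- The vertices of `P`: its extreme points. -/
def polytopeVertices {E : Type*} [AddCommGroup E] [Module ℝ E] (P : Set E) : Set E :=
  P.extremePoints ℝ

/-- The points `x` and `y` are the two endpoints of an edge of `P`, that is, of a one-dimensional
face of `P`: the nondegenerate segment `[x, y]` is the intersection of `P` with a supporting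
hyperplane, or is `P` itself. -/
def IsEdgeOf {E : Type*} [NormedAddCommGroup E] [NormedSpace ℝ E] (P : Set E) (x y : E) : Prop :=
  x ≠ y ∧ IsExposed ℝ P (segment ℝ x y)

/-- `P` is subequilateral with respect to the norm of `E`: the length of each of its edges equals
the diameter of `P`. -/
def IsSubequilateral {E : Type*} [NormedAddCommGroup E] [NormedSpace ℝ E] (P : Set E) : Prop :=
  ∀ x y : E, IsEdgeOf P x y → ‖x - y‖ = Metric.diam P

/-!
Write `D` for the diameter of `P`. The proof is a packing argument resting on the claim that any two
distinct vertices of `P` are at distance at least `2 * D / d`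
(`two_mul_diam_le_finrank_mul_norm_sub`). Given the claim, shrink the interior of `P` towards each
vertex `v` with ratio `k = 2 / (d + 2)`. A common point of the copies at `v` and `w` would give
interior points `p`, `q` of `P` with `d • (v - w) = 2 • (q - p)`, hence `‖v - w‖ < 2 * D / d`. So the
copies are pairwise disjoint subsets of the interior of `P`, and comparing volumes bounds their
number by `(1 / k) ^ d = (d / 2 + 1) ^ d`.

For the claim, if the segment between `v` and `w` misses the convex hull of the other vertices, then
`v` and `w` span an edge (`isEdgeOf_of_disjoint_segment`) and are at distance `D`. Otherwise the
segment contains a point `z` of that hull, and it suffices that `z` is at distance at least `D / d`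
from each of `v` and `w` (`diam_le_finrank_mul_norm_sub`).

To see this for `v`, write `z - v` as a nonnegative combination of the vectors `u - v`, with `u` a
vertex other than `v`. Weights of total `1` exist; choose weights `r u` of maximal total, and among
these an extreme choice, so that at most `d` weights are nonzero
(`exists_conic_combination_maximal_sum`). By maximality every `u` with `r u ≠ 0` is joined to `v` by
an edge: otherwise the segment from `v` to `u` meets the hull of the other vertices, and `u - v` can
be traded for a combination of larger total weight. Some weight satisfies `r u ≥ 1 / d`. Let `f` be a
functional of norm at most one with `f (u - v) = ‖u - v‖ = D`. Since no two points of `P` are further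
than `D` apart, `f` is nonnegative on `P - v`, so `‖z - v‖ ≥ f (z - v) ≥ r u * D ≥ D / d`.
-/

/-! ### Edges of the convex hull of finitely many points -/

open Set in
/-- A point outside the convex hull of the other points of a finite set is strictly exposed. -/
theorem exists_dual_lt_of_notMem_convexHull {E : Type*} [NormedAddCommGroup E] [NormedSpace ℝ E]
    {V : Finset E} {v : E} (hv : v ∉ convexHull ℝ ((V : Set E) \ {v})) :
    ∃ g : StrongDual ℝ E, ∀ u ∈ V, u ≠ v → g u < g v := by
  obtain ⟨g, c, h1, h2⟩ := geometric_hahn_banach_point_closed (convex_convexHull ℝ _)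
    ((V.finite_toSet.subset sdiff_subset).isClosed_convexHull ℝ) hv
  refine ⟨-g, fun u hu huv => ?_⟩
  have := h2 u (subset_convexHull ℝ _ ⟨hu, huv⟩)
  simp only [neg_apply]
  linarith

open Set in
/-- If the segment between two vertices misses the convex hull of the others, some functional
attains its maximum over the vertices exactly at these two: a functional separating the segment
from the hull is tilted, by a functional peaking at the lower endpoint, until its values at the
endpoints agree. -/
theorem exists_dual_eq_and_lt_of_disjoint_segment {E : Type*} [NormedAddCommGroup E]
    [NormedSpace ℝ E] {V : Finset E} (hV : ∀ v ∈ V, v ∉ convexHull ℝ ((V : Set E) \ {v}))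
    {v w : E} (hv : v ∈ V) (hw : w ∈ V) (hvw : v ≠ w)
    (hdisj : Disjoint (segment ℝ v w) (convexHull ℝ ((V : Set E) \ {v, w}))) :
    ∃ l : StrongDual ℝ E, l v = l w ∧ ∀ u ∈ V, u ≠ v → u ≠ w → l u < l v := by
  have hseg : IsCompact (segment ℝ v w) := by
    rw [← convexHull_pair]
    exact (toFinite _).isCompact_convexHull ℝ
  obtain ⟨f, a, b, h1, hab, h2⟩ := geometric_hahn_banach_compact_closed (convex_convexHull ℝ _)
    ((V.finite_toSet.subset sdiff_subset).isCompact_convexHull ℝ) (convex_segment v w)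
    hseg.isClosed hdisj.symm
  replace h1 : ∀ u ∈ V, u ≠ v → u ≠ w → f u < a := fun u hu huv huw =>
    h1 u (subset_convexHull ℝ _ ⟨hu, by simp [huv, huw]⟩)
  have h2v := h2 v (left_mem_segment ℝ v w)
  have h2w := h2 w (right_mem_segment ℝ v w)
  clear h2 hdisj hseg
  wlog hle : f w ≤ f v generalizing v w
  · obtain ⟨l, hl, hl'⟩ := this hw hv hvw.symm (fun u hu h h' => h1 u hu h' h) h2w h2v
      (le_of_not_ge hle)
    exact ⟨l, hl.symm, fun u hu h h' => hl ▸ hl' u hu h' h⟩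
  obtain ⟨g, hg⟩ := exists_dual_lt_of_notMem_convexHull (hV w hw)
  have hgv := hg v hv hvw
  have hpos : 0 < g w - g v := sub_pos.2 hgv
  set t := (f v - f w) / (g w - g v) with ht
  have ht0 : 0 ≤ t := div_nonneg (sub_nonneg.2 hle) hpos.le
  have htmul : t * (g w - g v) = f v - f w := div_mul_cancel₀ _ hpos.ne'
  have heq : (f + t • g) v = (f + t • g) w := by
    simp only [add_apply, smul_apply, smul_eq_mul]
    linarith
  refine ⟨f + t • g, heq, fun u hu huv huw => ?_⟩
  rw [heq]
  simp only [add_apply, smul_apply, smul_eq_mul]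
  have := mul_le_mul_of_nonneg_left (hg u hu huw).le ht0
  linarith [h1 u hu huv huw]

open Set in
/-- Two vertices whose segment misses the convex hull of the other vertices span an edge. -/
theorem isEdgeOf_of_disjoint_segment {E : Type*} [NormedAddCommGroup E] [NormedSpace ℝ E]
    {V : Finset E} (hV : ∀ v ∈ V, v ∉ convexHull ℝ ((V : Set E) \ {v}))
    {v w : E} (hv : v ∈ V) (hw : w ∈ V) (hvw : v ≠ w)
    (hdisj : Disjoint (segment ℝ v w) (convexHull ℝ ((V : Set E) \ {v, w}))) :
    IsEdgeOf (convexHull ℝ (V : Set E)) v w := by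
  classical
  obtain ⟨l, hl, hlt⟩ := exists_dual_eq_and_lt_of_disjoint_segment hV hv hw hvw hdisj
  have hle : ∀ u ∈ V, l u ≤ l v := fun u hu => by
    by_cases huv : u = v
    · rw [huv]
    by_cases huw : u = w
    · rw [huw, hl]
    exact (hlt u hu huv huw).le
  have hmax : ∀ y ∈ convexHull ℝ (V : Set E), l y ≤ l v := fun y hy =>
    convexHull_min (fun u hu => hle u hu)
      (convex_halfSpace_le l.toLinearMap.isLinear (l v)) hy
  refine ⟨hvw, fun _ => ⟨l, Subset.antisymm (fun x hx => ⟨?_, fun y hy => ?_⟩) ?_⟩⟩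
  · exact segment_subset_convexHull (by exact hv) (by exact hw) hx
  · have : l x = l v := by
      obtain ⟨a, b, -, -, hab, rfl⟩ := hx
      simp only [map_add, map_smul, smul_eq_mul, ← hl, ← add_mul, hab, one_mul]
    exact this ▸ hmax y hy
  · rintro x ⟨hx, hxmax⟩
    have hlx : l v ≤ l x := hxmax v (subset_convexHull ℝ _ hv)
    obtain ⟨c, hc0, hc1, rfl⟩ := Finset.mem_convexHull'.1 hx
    -- a point of the hull at the maximal level carries no weight off `v` and `w`
    have hsum : ∑ u ∈ V, c u * (l v - l u) ≤ 0 := by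
      simp only [map_sum, map_smul, smul_eq_mul] at hlx
      simp only [mul_sub, Finset.sum_sub_distrib, ← Finset.sum_mul, hc1, one_mul]
      linarith
    have hnn : ∀ u ∈ V, 0 ≤ c u * (l v - l u) := fun u hu =>
      mul_nonneg (hc0 u hu) (sub_nonneg.2 (hle u hu))
    have hz := (Finset.sum_eq_zero_iff_of_nonneg hnn).1
      (le_antisymm hsum (Finset.sum_nonneg hnn))
    have hc : ∀ u ∈ V, u ∉ ({v, w} : Finset E) → c u = 0 := fun u hu hu' => by
      simp only [Finset.mem_insert, Finset.mem_singleton, not_or] at hu'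
      exact (mul_eq_zero.1 (hz u hu)).resolve_right
        (sub_pos.2 (hlt u hu hu'.1 hu'.2)).ne'
    have hsub : ({v, w} : Finset E) ⊆ V := by simp [Finset.insert_subset_iff, hv, hw]
    rw [← Finset.sum_subset hsub hc, Finset.sum_pair hvw] at hc1
    rw [← Finset.sum_subset hsub fun u hu hu' => by rw [hc u hu hu', zero_smul],
      Finset.sum_pair hvw]
    exact ⟨c v, c w, hc0 v hv, hc0 w hw, hc1, rfl⟩

/-! ### Conic combinations of maximal total weight -/

open Set Filter Topology in
/-- A conic combination of vectors in an open half-space can be rewritten so that its total weight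
is maximal and at most `dim E` of the weights are nonzero. The nonnegative weight vectors
representing the given point form a compact polytope, and an extreme point of its face of maximal
total weight has linearly independent support. -/
theorem exists_conic_combination_maximal_sum {E ι : Type*} [NormedAddCommGroup E] [NormedSpace ℝ E]
    [FiniteDimensional ℝ E] [Fintype ι] (a : ι → E) (h : StrongDual ℝ E) (ha : ∀ i, 0 < h (a i))
    (c : ι → ℝ) (hc : 0 ≤ c) :
    ∃ r : ι → ℝ, 0 ≤ r ∧ ∑ i, r i • a i = ∑ i, c i • a i ∧
      (∀ s : ι → ℝ, 0 ≤ s → ∑ i, s i • a i = ∑ i, c i • a i → ∑ i, s i ≤ ∑ i, r i) ∧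
      (Finset.univ.filter fun i => r i ≠ 0).card ≤ Module.finrank ℝ E := by
  classical
  set y := ∑ i, c i • a i with hy
  let S : Set (ι → ℝ) := {s | 0 ≤ s ∧ ∑ i, s i • a i = y}
  have hScl : IsClosed S := by
    refine (isClosed_le continuous_const continuous_id).inter (isClosed_eq ?_ continuous_const)
    fun_prop
  have hSsub : S ⊆ Icc 0 fun i => h y / h (a i) := by
    rintro s ⟨hs0, hsy⟩
    refine ⟨hs0, fun i => ?_⟩
    rw [le_div_iff₀ (ha i), ← hsy]
    simp only [map_sum, map_smul, smul_eq_mul]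
    exact Finset.single_le_sum (f := fun i => s i * h (a i))
      (fun j _ => mul_nonneg (hs0 j) (ha j).le) (Finset.mem_univ i)
  have hScomp : IsCompact S := isCompact_Icc.of_isClosed_subset hScl hSsub
  have hcont : Continuous fun s : ι → ℝ => ∑ i, s i := by fun_prop
  obtain ⟨m, hmS, hm⟩ := hScomp.exists_isMaxOn ⟨c, hc, rfl⟩ hcont.continuousOn
  let M : Set (ι → ℝ) := S ∩ {s | ∑ i, m i ≤ ∑ i, s i}
  have hMcomp : IsCompact M := hScomp.inter_right (isClosed_le continuous_const hcont)
  obtain ⟨r, hrM, hrext⟩ := hMcomp.extremePoints_nonempty ⟨m, hmS, le_refl (∑ i, m i)⟩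
  refine ⟨r, hrM.1.1, hrM.1.2, fun s hs0 hsy => (hm ⟨hs0, hsy⟩).trans hrM.2, ?_⟩
  have hli : LinearIndependent ℝ fun i : {i // r i ≠ 0} => a i := by
    rw [Fintype.linearIndependent_iff]
    intro q hq
    let p : ι → ℝ := fun i => if hi : r i ≠ 0 then q ⟨i, hi⟩ else 0
    have hp0 : ∀ i, r i = 0 → p i = 0 := fun i hi => by simp [p, hi]
    have hpa : ∑ i, p i • a i = 0 := by
      rw [← hq, ← Finset.sum_filter_of_ne (p := fun i => r i ≠ 0)
        fun i _ hi hri => hi (by rw [hp0 i hri, zero_smul]),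
        Finset.sum_subtype _ (p := fun i => r i ≠ 0) (by simp)]
      exact Finset.sum_congr rfl fun i _ => by simp [p, i.2]
    -- moving `r` slightly along a linear relation, in either direction, stays in `S`
    obtain ⟨ε, hε0, hε⟩ : ∃ ε > 0, ∀ i, ε * |p i| ≤ r i := by
      have : ∀ᶠ ε in 𝓝[>] (0 : ℝ), ∀ i, ε * |p i| ≤ r i := by
        refine eventually_all.2 fun i => ?_
        by_cases hi : r i = 0
        · simp [hi, hp0 i hi]
        have hri : 0 < r i := lt_of_le_of_ne (hrM.1.1 i) (Ne.symm hi)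
        have ht : Tendsto (fun ε : ℝ => ε * |p i|) (𝓝[>] 0) (𝓝 0) := by
          have : Continuous fun ε : ℝ => ε * |p i| := by fun_prop
          simpa using (this.tendsto 0).mono_left nhdsWithin_le_nhds
        filter_upwards [ht.eventually_lt_const hri] with ε h using h.le
      obtain ⟨ε, h1, h2⟩ := (this.and self_mem_nhdsWithin).exists
      exact ⟨ε, h2, h1⟩
    have hmem : ∀ δ : ℝ, |δ| = ε → r + δ • p ∈ S := fun δ hδ => by
      refine ⟨fun i => ?_, ?_⟩
      · have h1 := neg_abs_le (δ * p i)
        rw [abs_mul, hδ] at h1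
        simp only [Pi.zero_apply, Pi.add_apply, Pi.smul_apply, smul_eq_mul]
        linarith [hε i]
      · simp only [Pi.add_apply, Pi.smul_apply, smul_eq_mul, add_smul, mul_smul,
          Finset.sum_add_distrib, ← Finset.smul_sum, hpa, smul_zero, add_zero]
        exact hrM.1.2
    have h1 := hmem ε (abs_of_pos hε0)
    have h2 := hmem (-ε) (by rw [abs_neg, abs_of_pos hε0])
    have hs1 := hm h1
    have hs2 := hm h2
    have hs3 := hrM.2
    simp only [Pi.add_apply, Pi.smul_apply, smul_eq_mul, Finset.sum_add_distrib,
      ← Finset.mul_sum, mem_ofPred_eq] at hs1 hs2 hs3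
    -- by maximality of the total weight, the relation has coefficient sum zero
    have h1M : r + ε • p ∈ M := ⟨h1, by
      simp only [Pi.add_apply, Pi.smul_apply, smul_eq_mul, Finset.sum_add_distrib,
        ← Finset.mul_sum, mem_ofPred_eq]
      linarith⟩
    have h2M : r + (-ε) • p ∈ M := ⟨h2, by
      simp only [Pi.add_apply, Pi.smul_apply, smul_eq_mul, Finset.sum_add_distrib,
        ← Finset.mul_sum, mem_ofPred_eq]
      linarith⟩
    have hrp := hrext h1M h2M ⟨1 / 2, 1 / 2, by norm_num, by norm_num, by norm_num, by
      module⟩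
    intro i
    have := congrFun hrp i
    simp only [Pi.add_apply, Pi.smul_apply, smul_eq_mul, add_eq_left, mul_eq_zero,
      hε0.ne', false_or] at this
    simpa [p, i.2] using this
  have := hli.fintype_card_le_finrank
  rwa [Fintype.card_subtype] at this

/-! ### Distances between vertices -/

open Set in
/-- In a subequilateral polytope, the distance from a vertex `v` to the convex hull of the other
vertices is at least the diameter divided by the dimension. -/
theorem diam_le_finrank_mul_norm_sub {E : Type*} [NormedAddCommGroup E] [NormedSpace ℝ E]
    [FiniteDimensional ℝ E] {V : Finset E} (hV : ∀ v ∈ V, v ∉ convexHull ℝ ((V : Set E) \ {v}))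
    (hsub : IsSubequilateral (convexHull ℝ (V : Set E))) {v z : E} (hv : v ∈ V)
    (hz : z ∈ convexHull ℝ ((V : Set E) \ {v})) :
    Metric.diam (convexHull ℝ (V : Set E)) ≤ Module.finrank ℝ E * ‖z - v‖ := by
  classical
  set D := Metric.diam (convexHull ℝ (V : Set E)) with hD
  set W := V.erase v with hW
  have hWV : (W : Set E) = (V : Set E) \ {v} := by simp [hW]
  have hweights : ∀ x ∈ convexHull ℝ ((V : Set E) \ {v}), ∃ c : W → ℝ, 0 ≤ c ∧ ∑ u, c u = 1 ∧
      ∑ u, c u • ((u : E) - v) = x - v := fun x hx => by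
    rw [← hWV, Finset.mem_convexHull'] at hx
    obtain ⟨c, h0, h1, rfl⟩ := hx
    have h1' : ∑ u : W, c u = 1 := by rw [← h1]; exact Finset.sum_coe_sort W c
    refine ⟨fun u => c u, fun u => h0 u u.2, h1', ?_⟩
    simp only [smul_sub, Finset.sum_sub_distrib, ← Finset.sum_smul, h1', one_smul]
    rw [Finset.sum_coe_sort W fun u => c u • u]
  obtain ⟨g, hg⟩ := exists_dual_lt_of_notMem_convexHull (hV v hv)
  obtain ⟨c, hc0, hc1, hcz⟩ := hweights z hz
  obtain ⟨r, hr0, hrz, hrmax, hrcard⟩ := exists_conic_combination_maximal_sum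
    (fun u : W => (u : E) - v) (-g) (fun u => by
      have := hg u (Finset.mem_of_mem_erase u.2) (Finset.ne_of_mem_erase u.2)
      simp only [neg_apply, map_sub]
      linarith) c hc0
  rw [hcz] at hrz hrmax
  have hsum : 1 ≤ ∑ u, r u := hc1 ▸ hrmax c hc0 hcz
  have hedge : ∀ u : W, r u ≠ 0 → IsEdgeOf (convexHull ℝ (V : Set E)) v u := by
    intro x hx
    have hxV := Finset.mem_of_mem_erase x.2
    have hxv := Finset.ne_of_mem_erase x.2
    refine isEdgeOf_of_disjoint_segment hV hv hxV hxv.symm ?_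
    by_contra hnd
    obtain ⟨p, hps, hpc⟩ := not_disjoint_iff.1 hnd
    have hpx : p ≠ x := fun h => hV x hxV
      (convexHull_mono (sdiff_subset_sdiff_right (by simp)) (h ▸ hpc))
    have hpc' : p ∈ convexHull ℝ ((V : Set E) \ {v}) :=
      convexHull_mono (sdiff_subset_sdiff_right (by simp)) hpc
    have hpv : p ≠ v := fun h => hV v hv (h ▸ hpc')
    rw [segment_eq_image'] at hps
    obtain ⟨t, ⟨ht0, ht1⟩, rfl⟩ := hps
    have ht0' : 0 < t := lt_of_le_of_ne ht0 fun h => hpv (by simp [← h])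
    have ht1' : t < 1 := lt_of_le_of_ne ht1 fun h => hpx (by simp [h])
    obtain ⟨q, hq0, hq1, hqx⟩ := hweights _ hpc'
    rw [add_sub_cancel_left] at hqx
    have hrx : 0 < r x := lt_of_le_of_ne (hr0 x) (Ne.symm hx)
    -- trading the weight of `x` for the combination `q` scales that weight by `1 / t > 1`
    have hlt := hrmax (fun u => Function.update r x 0 u + r x / t * q u)
      (fun u => add_nonneg (by
        by_cases hu : u = x
        · simp [hu]
        · simpa [hu] using hr0 u) (mul_nonneg (div_nonneg hrx.le ht0) (hq0 u))) (by
        have hup : ∑ u : W, Function.update r x 0 u • ((u : E) - v) =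
            z - v - r x • ((x : E) - v) := by
          rw [← hrz, eq_sub_iff_add_eq, ← Finset.add_sum_erase _ _ (Finset.mem_univ x),
            ← Finset.add_sum_erase _ (fun u : W => r u • ((u : E) - v)) (Finset.mem_univ x),
            Function.update_self, zero_smul, zero_add, add_comm]
          congr 1
          exact Finset.sum_congr rfl fun u hu => by
            rw [Function.update_of_ne (Finset.ne_of_mem_erase hu)]
        simp only [add_smul, mul_smul, Finset.sum_add_distrib, ← Finset.smul_sum, hqx, hup]
        rw [smul_smul, div_mul_cancel₀ _ ht0'.ne', sub_add_cancel])
    have hup : ∑ u, Function.update r x 0 u = ∑ u, r u - r x := by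
      rw [Finset.sum_update_of_mem (Finset.mem_univ x), zero_add, eq_sub_iff_add_eq, add_comm,
        Finset.sdiff_singleton_eq_erase, Finset.add_sum_erase _ _ (Finset.mem_univ x)]
    rw [Finset.sum_add_distrib, ← Finset.mul_sum, hq1, hup, mul_one] at hlt
    have : r x < r x / t := by
      rw [lt_div_iff₀ ht0']
      nlinarith
    linarith
  obtain ⟨i, hi0, hi⟩ : ∃ i, r i ≠ 0 ∧ 1 ≤ Module.finrank ℝ E * r i := by
    by_contra! hcon
    have hs : ∑ u, r u = ∑ u with r u ≠ 0, r u := (Finset.sum_filter_ne_zero _).symm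
    rw [hs] at hsum
    have hne : (Finset.univ.filter fun u => r u ≠ 0).Nonempty := by
      rw [Finset.nonempty_iff_ne_empty]
      intro h
      rw [h, Finset.sum_empty] at hsum
      linarith
    have hn : (0 : ℝ) < Module.finrank ℝ E := by exact_mod_cast hne.card_pos.trans_le hrcard
    have h1 : ∑ u with r u ≠ 0, Module.finrank ℝ E * r u < ∑ u with r u ≠ 0, (1 : ℝ) :=
      Finset.sum_lt_sum_of_nonempty hne fun u hu => hcon u (Finset.mem_filter.1 hu).2
    rw [← Finset.mul_sum, Finset.sum_const, nsmul_one] at h1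
    have h2 : ((Finset.univ.filter fun u => r u ≠ 0).card : ℝ) ≤ Module.finrank ℝ E := by
      exact_mod_cast hrcard
    nlinarith
  have hnorm : ‖(i : E) - v‖ = D := by rw [← norm_sub_rev]; exact hsub _ _ (hedge i hi0)
  obtain ⟨f, hf1, hf⟩ := exists_dual_vector'' ℝ ((i : E) - v)
  have hfle : ∀ x, f x ≤ ‖x‖ := fun x =>
    (le_abs_self _).trans ((f.le_of_opNorm_le hf1 x).trans_eq (one_mul _))
  -- a norming functional of a longest edge at `v` attains its minimum over the polytope at `v`
  have hfnn : ∀ u : W, 0 ≤ f ((u : E) - v) := fun u => by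
    have h1 := hfle (i - u)
    have h2 : ‖(i : E) - u‖ ≤ D := by
      rw [← dist_eq_norm]
      exact Metric.dist_le_diam_of_mem (V.finite_toSet.isCompact_convexHull ℝ).isBounded
        (subset_convexHull ℝ _ (Finset.mem_of_mem_erase i.2))
        (subset_convexHull ℝ _ (Finset.mem_of_mem_erase u.2))
    simp only [map_sub, RCLike.ofReal_real_eq_id, id_eq] at *
    linarith
  have hfz : r i * D ≤ f (z - v) := by
    rw [← hrz, map_sum, ← hnorm]
    have : r i * ‖(i : E) - v‖ = f (r i • ((i : E) - v)) := by rw [map_smul, hf]; rfl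
    rw [this]
    exact Finset.single_le_sum (f := fun u : W => f (r u • ((u : E) - v)))
      (fun u _ => by
        rw [map_smul]
        exact mul_nonneg (hr0 u) (hfnn u)) (Finset.mem_univ i)
  have hD0 : 0 ≤ D := Metric.diam_nonneg
  calc D ≤ (Module.finrank ℝ E * r i) * D := le_mul_of_one_le_left hD0 hi
    _ = Module.finrank ℝ E * (r i * D) := mul_assoc _ _ _
    _ ≤ _ := mul_le_mul_of_nonneg_left (hfz.trans (hfle _)) (Nat.cast_nonneg _)

open Set in
/-- Distinct vertices of a subequilateral polytope are at distance at least `2 / d` times the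
diameter: unless they span an edge, their segment meets the hull of the remaining vertices, and the
meeting point is far from both. -/
theorem two_mul_diam_le_finrank_mul_norm_sub {E : Type*} [NormedAddCommGroup E] [NormedSpace ℝ E]
    [FiniteDimensional ℝ E] (hd : 2 ≤ Module.finrank ℝ E) {V : Finset E}
    (hV : ∀ v ∈ V, v ∉ convexHull ℝ ((V : Set E) \ {v}))
    (hsub : IsSubequilateral (convexHull ℝ (V : Set E))) {v w : E} (hv : v ∈ V) (hw : w ∈ V)
    (hvw : v ≠ w) :
    2 * Metric.diam (convexHull ℝ (V : Set E)) ≤ Module.finrank ℝ E * ‖v - w‖ := by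
  by_cases hdisj : Disjoint (segment ℝ v w) (convexHull ℝ ((V : Set E) \ {v, w}))
  · rw [hsub v w (isEdgeOf_of_disjoint_segment hV hv hw hvw hdisj)]
    exact mul_le_mul_of_nonneg_right (by exact_mod_cast hd) Metric.diam_nonneg
  obtain ⟨z, hzs, hzc⟩ := not_disjoint_iff.1 hdisj
  have h1 := diam_le_finrank_mul_norm_sub hV hsub hv
    (convexHull_mono (sdiff_subset_sdiff_right (by simp)) hzc)
  have h2 := diam_le_finrank_mul_norm_sub hV hsub hw
    (convexHull_mono (sdiff_subset_sdiff_right (by simp)) hzc)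
  have h3 := dist_add_dist_of_mem_segment hzs
  rw [dist_comm v z, dist_eq_norm, dist_eq_norm, dist_eq_norm] at h3
  rw [← h3, mul_add]
  linarith

/-! ### Packing homothetic copies -/

open Filter Topology in
theorem dist_lt_diam_of_mem_interior {E : Type*} [NormedAddCommGroup E] [NormedSpace ℝ E]
    {P : Set E} (hb : Bornology.IsBounded P) {p q : E} (hp : p ∈ interior P) (hq : q ∈ P)
    (hpq : p ≠ q) : dist p q < Metric.diam P := by
  have hcont : Tendsto (fun ε : ℝ => p + ε • (p - q)) (𝓝[>] 0) (𝓝 p) := by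
    have : Continuous fun ε : ℝ => p + ε • (p - q) := by fun_prop
    simpa using (this.tendsto 0).mono_left nhdsWithin_le_nhds
  obtain ⟨ε, hε, hε0⟩ :=
    ((hcont.eventually (mem_interior_iff_mem_nhds.1 hp)).and self_mem_nhdsWithin).exists
  replace hε0 : 0 < ε := hε0
  have hle := Metric.dist_le_diam_of_mem hb hε hq
  rw [dist_eq_norm, show p + ε • (p - q) - q = (1 + ε) • (p - q) by module, norm_smul,
    Real.norm_of_nonneg (by linarith)] at hle
  have hpos : 0 < ‖p - q‖ := norm_pos_iff.2 (sub_ne_zero.2 hpq)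
  rw [dist_eq_norm]
  nlinarith

open MeasureTheory Set in
/-- Packing bound: if the homothetic copies of the interior of a bounded convex body with ratio
`k`, centred at points of the body, are pairwise disjoint, then their number is at most
`(1 / k) ^ d`. -/
theorem card_mul_pow_le_one_of_pairwiseDisjoint_homothety {E : Type*} [NormedAddCommGroup E]
    [NormedSpace ℝ E] [FiniteDimensional ℝ E] {P : Set E} (hP : Convex ℝ P)
    (hb : Bornology.IsBounded P) (hne : (interior P).Nonempty) {k : ℝ} (hk0 : 0 < k) (hk1 : k ≤ 1)
    {V : Finset E} (hVP : (V : Set E) ⊆ P)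
    (hdisj : (V : Set E).PairwiseDisjoint fun v => AffineMap.homothety v k '' interior P) :
    (V.card : ℝ) * k ^ Module.finrank ℝ E ≤ 1 := by
  borelize E
  let μ : Measure E := Measure.addHaar
  have hopen : ∀ v ∈ V, MeasurableSet (AffineMap.homothety v k '' interior P) := fun v _ =>
    (AffineMap.homothety_isOpenMap v k hk0.ne' _ isOpen_interior).measurableSet
  have hsub : ⋃ v ∈ V, AffineMap.homothety v k '' interior P ⊆ interior P := by
    refine iUnion₂_subset fun v hv => ?_
    rintro _ ⟨p, hp, rfl⟩
    rw [AffineMap.homothety_apply, vsub_eq_sub, vadd_eq_add,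
      show k • (p - v) + v = k • p + (1 - k) • v by module]
    exact hP.combo_interior_self_subset_interior hk0 (sub_nonneg.2 hk1) (by ring)
      (add_mem_add (smul_mem_smul_set hp) (smul_mem_smul_set (hVP hv)))
  have hle := measure_mono (μ := μ) hsub
  rw [measure_biUnion_finset hdisj hopen] at hle
  simp only [Measure.addHaar_image_homothety, Finset.sum_const, nsmul_eq_mul] at hle
  have hpos : μ (interior P) ≠ 0 := (isOpen_interior.measure_pos μ hne).ne'
  have hfin : μ (interior P) ≠ ⊤ := (hb.subset interior_subset).measure_lt_top.ne
  rw [← mul_assoc, ← ENNReal.le_div_iff_mul_le (Or.inl hpos) (Or.inl hfin),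
    ENNReal.div_self hpos hfin] at hle
  rw [abs_of_pos (by positivity),
    ← ENNReal.ofReal_natCast, ← ENNReal.ofReal_mul (by positivity), ENNReal.ofReal_le_one] at hle
  exact hle

/-! ### The bound on the number of vertices -/

theorem theorem2 {E : Type*} [NormedAddCommGroup E] [NormedSpace ℝ E] (d : ℕ) (hd : 2 ≤ d)
    (hE : Module.finrank ℝ E = d) (P : Set E) (hP : IsDPolytope d P)
    (hsub : IsSubequilateral P) :
    (polytopeVertices P).Finite ∧
      ((polytopeVertices P).ncard : ℝ) ≤ ((d : ℝ) / 2 + 1) ^ d := by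
  subst hE
  have : FiniteDimensional ℝ E := Module.finite_of_finrank_pos (by omega)
  obtain ⟨⟨s, hs⟩, hdim⟩ := hP
  have hcomp : IsCompact P := hs ▸ s.finite_toSet.isCompact_convexHull ℝ
  have hconv : Convex ℝ P := hs ▸ convex_convexHull ℝ _
  have hfin : (polytopeVertices P).Finite :=
    s.finite_toSet.subset (by rw [polytopeVertices, hs]; exact extremePoints_convexHull_subset)
  refine ⟨hfin, ?_⟩
  obtain ⟨V, hVP⟩ := hfin.exists_finset_coe
  rw [← hVP, Set.ncard_coe_finset]
  rw [polytopeVertices] at hVP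
  have hhull : convexHull ℝ (V : Set E) = P := by
    have := closure_convexHull_extremePoints hcomp hconv
    rwa [← hVP, (V.finite_toSet.isClosed_convexHull ℝ).closure_eq] at this
  have hV : ∀ v ∈ V, v ∉ convexHull ℝ ((V : Set E) \ {v}) := fun v hv hmem => by
    have hvP : v ∈ P.extremePoints ℝ := hVP ▸ hv
    rw [hconv.mem_extremePoints_iff_convex_sdiff] at hvP
    exact (convexHull_min (Set.sdiff_subset_sdiff_left (hhull ▸ subset_convexHull ℝ _)) hvP.2 hmem).2
      rfl
  have hne : P.Nonempty := by
    by_contra h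
    rw [Set.not_nonempty_iff_eq_empty] at h
    rw [h, vectorSpan_empty, finrank_bot] at hdim
    omega
  have hint : (interior P).Nonempty := by
    rw [hconv.interior_nonempty_iff_affineSpan_eq_top,
      AffineSubspace.affineSpan_eq_top_iff_vectorSpan_eq_top_of_nonempty ℝ E E hne]
    exact Submodule.eq_top_of_finrank_eq hdim
  have hn2 : (2 : ℝ) ≤ Module.finrank ℝ E := by exact_mod_cast hd
  set n : ℝ := (↑(Module.finrank ℝ E) : ℝ) with hn
  have hkey := card_mul_pow_le_one_of_pairwiseDisjoint_homothety hconv hcomp.isBounded hint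
    (k := 2 / (n + 2)) (by positivity) (by rw [div_le_one (by positivity)]; linarith) (V := V)
    (hhull ▸ subset_convexHull ℝ _) (by
      intro v hv w hw hvw
      rw [Function.onFun, Set.disjoint_left]
      rintro _ ⟨p, hp, rfl⟩ ⟨q, hq, hpq⟩
      have hfar := two_mul_diam_le_finrank_mul_norm_sub hd hV (hhull.symm ▸ hsub) hv hw hvw
      rw [hhull, ← hn] at hfar
      simp only [AffineMap.homothety_apply, vsub_eq_sub, vadd_eq_add] at hpq
      have hvec : n • (v - w) = (2 : ℝ) • (q - p) := by
        have h2 : (n + 2) • ((2 / (n + 2)) • (q - w) + w) =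
            (n + 2) • ((2 / (n + 2)) • (p - v) + v) := by rw [hpq]
        rw [smul_add, smul_add, smul_smul, smul_smul, mul_div_cancel₀ _ (by positivity)] at h2
        rw [← sub_eq_zero] at h2 ⊢
        rw [← neg_eq_zero, ← h2]
        module
      have hnorm : n * ‖v - w‖ = 2 * ‖q - p‖ := by
        have := congrArg norm hvec
        rwa [norm_smul, norm_smul, Real.norm_of_nonneg (by linarith),
          Real.norm_of_nonneg (by norm_num)] at this
      have hpos : 0 < ‖v - w‖ := norm_pos_iff.2 (sub_ne_zero.2 hvw)
      have hpq' : p ≠ q := by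
        rintro rfl
        rw [sub_self, norm_zero, mul_zero] at hnorm
        nlinarith
      have hlt := dist_lt_diam_of_mem_interior hcomp.isBounded hp (interior_subset hq) hpq'
      rw [dist_comm, dist_eq_norm] at hlt
      linarith)
  have hinv : (n / 2 + 1) * (2 / (n + 2)) = 1 := by field_simp
  have hpow : (n / 2 + 1) ^ Module.finrank ℝ E * (2 / (n + 2)) ^ Module.finrank ℝ E = 1 := by
    rw [← mul_pow, hinv, one_pow]
  have hk : 0 < (2 / (n + 2)) ^ Module.finrank ℝ E := by positivity
  exact le_of_mul_le_mul_right (hkey.trans_eq hpow.symm) hk
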